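/- **Setting.** Let $G$ be a finite directed acyclic network with a source and a destination. A link is internal if it is incident to neither of them; let $d$ be the number of internal links. The external links have delay $0$, so a path from source to destination is identified with its incidence vector in $\{0,1\}^d$ over the internal links; $\mathcal A\subseteq\{0,1\}^d$ is the set of all paths. Assume identifiability: $\mathcal A$ spans $\mathbb R^d$. The unknown mean delays are $\mu\in[0,1]^d$. In round $t=1,\dots,T$ the algorithm selects $a_{I_t}\in\mathcal A$ and observes only $\langle a_{I_t},\mu\rangle+\eta_t$, where, given the past selections and the past noise, $\eta_t$ has mean $0$ and is $R$-sub-Gaussian ($R\ge 0$ known). The shortest path $a_*=\operatorname{argmin}_{a\in\mathcal A}\langle a,\mu\rangle$ is unique; $\Delta_{\max}$ and $\Delta_{\min}$ are the largest and the smallest value of $\langle a-a_*,\mu\rangle$ over $a\in\mathcal A\setminus\{a_*\}$ (both $0$ if $\mathcal A=\{a_*\}$). The regret is $\mathrm{Regret}_T=\sum_{t\le T}(\langle a_{I_t},\mu\rangle+\eta_t)-\min_{a\in\mathcal A}\sum_{t\le T}(\langle a,\mu\rangle+\eta_t)$. **Top-Two Comparison (TTC) algorithm.** Its input is $\mathcal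 A$, $S$, $R$, $T$ and an $S$-approximate barycentric spanner $b_1,\dots,b_d\in\mathcal A$ (every $a\in\mathcal A$ is $\sum_i\nu_ib_i$ with all $\nu_i\in[-S,S]$), but not $\Delta_{\min}$. Put $\tilde\Delta_m=SR\sqrt{(2\ln(2)d^2+8d\ln T)/m}$ and $\mathcal A_1=\mathcal A$. In epoch $m=1,2,\dots$: if $|\mathcal A_m|=1$, select the path in $\mathcal A_m$ and put $\mathcal A_{m+1}=\mathcal A_m$. Otherwise select each $b_i$ once, let $\hat\mu_m$ be the ordinary least squares estimate of $\mu$ from all $md$ observations, let $\tilde a_m$ be a minimizer of $\langle a,\hat\mu_m\rangle$ over $\mathcal A_m$ (the estimated shortest path) and $\bar a_m$ one over $\mathcal A_m\setminus\{\tilde a_m\}$ (the estimated second shortest path); put $\mathcal A_{m+1}=\{\tilde a_m\}$ if $\langle\bar a_m-\tilde a_m,\hat\mu_m\rangle>2\tilde\Delta_m$, and $\mathcal A_{m+1}=\mathcal A_m$ otherwise. The algorithm stops after $T$ rounds. **Theorem.** There is an absolute constant $C$ such that, for every such problem and every $$T\ \ge\ d\,\overline m,\qquad \overline m=\frac{S^2R^2\,(32\ln(2)\,d^2+128\,d\ln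 T)}{\Delta_{\min}^2},$$ the TTC algorithm satisfies $$\mathbb E[\mathrm{Regret}_T]\ \le\ C\,(1+S^2R^2)\,\frac{(d^2\ln T+d^3)\,\Delta_{\max}}{\Delta_{\min}^2},$$ that is, $O\big((d^2\ln T+d^3)\Delta_{\max}/\Delta_{\min}^2\big)$ for fixed $S$ and $R$. Moreover, with probability at least $1-1/(dT)$, in every epoch $m$ with $md\le T$ and $|\mathcal A_m|\neq1$ in which $\langle\bar a_m-\tilde a_m,\hat\mu_m\rangle>2\tilde\Delta_m$, all suboptimal paths and only these are eliminated: $\mathcal A_{m+1}=\{a_*\}$. (If $\mathcal A=\{a_*\}$, quotients with denominator $0$ are read as $0$: the regret is $0$ and nothing is eliminated.) -/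

import Mathlib

open MeasureTheory ProbabilityTheory
open scoped Matrix

/-! ### Networks, paths, and identifiability -/

/-- A directed network with vertices `V` and links `E` (parallel links are allowed), together with
the source and the destination of the packets. -/
structure RoutingNetwork (V E : Type*) where
  src : E → V
  tgt : E → V
  source : V
  dest : V

namespace RoutingNetwork

variable {V E : Type*} (N : RoutingNetwork V E)

/-- `N.IsWalk u v p`: the list of links `p` is a directed walk from `u` to `v`. -/
def IsWalk : V → V → List E → Prop
  | u, v, [] => u = v
  | u, v, e :: p => N.src e = u ∧ IsWalk (N.tgt e) v p

/-- There is no nonempty closed directed walk. -/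
def Acyclic : Prop := ∀ (v : V) (p : List E), N.IsWalk v v p → p = []

/-- The internal links: those that are incident neither to the source nor to the destination. -/
def InternalLink : Type _ :=
  {e : E // N.src e ≠ N.source ∧ N.src e ≠ N.dest ∧ N.tgt e ≠ N.source ∧ N.tgt e ≠ N.dest}

noncomputable instance [Finite E] : Fintype N.InternalLink :=
  haveI : Finite N.InternalLink := Subtype.finite
  Fintype.ofFinite _

open Classical in
/-- The incidence vector of a list of links, over the internal links. External links have
delay zero and are not recorded. -/
noncomputable def pathVector (p : List E) : N.InternalLink → ℝ :=
  fun e => if e.1 ∈ p then 1 else 0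

/-- The set of (incidence vectors of) all paths from the source to the destination. In an acyclic
network every directed walk is a path. -/
def pathVectors : Set (N.InternalLink → ℝ) :=
  {a | ∃ p : List E, N.IsWalk N.source N.dest p ∧ a = N.pathVector p}

theorem pathVectors_finite [Finite E] : N.pathVectors.Finite := by
  classical
  refine (Set.finite_range
    (fun F : Set N.InternalLink => fun e => if e ∈ F then (1 : ℝ) else 0)).subset ?_
  rintro a ⟨p, -, rfl⟩
  exact ⟨{e | e.1 ∈ p}, by ext e; simp [pathVector]⟩

/-- The set of all paths, as a finite set of vectors in `{0,1}^d`, `d` the number of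
internal links. -/
noncomputable def pathSet [Finite E] : Finset (N.InternalLink → ℝ) :=
  N.pathVectors_finite.toFinset

/-- The internal network is identifiable: the paths span the whole space. -/
def Identifiable : Prop := Submodule.span ℝ N.pathVectors = ⊤

end RoutingNetwork

/-- `b₁, …, b_d` is an `S`-approximate barycentric spanner of `W₀`: the span of `W₀` has dimension
`d`, the `bᵢ` belong to `W₀`, and every element of `W₀` is a linear combination of them with
coefficients in `[-S, S]`. -/
def IsApproxBarycentricSpanner {W : Type*} [AddCommGroup W] [Module ℝ W] (W₀ : Set W) (S : ℝ)
    {d : ℕ} (b : Fin d → W) : Prop :=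
  Module.finrank ℝ (Submodule.span ℝ W₀) = d ∧ (∀ i, b i ∈ W₀) ∧
    ∀ x ∈ W₀, ∃ ν : Fin d → ℝ, (∀ i, ν i ∈ Set.Icc (-S) S) ∧ x = ∑ i, ν i • b i

/-! ### The online routing problem with end-to-end feedback

Rounds are numbered `0, 1, …, T - 1`. Paths are vectors `a : ι → ℝ`, `ι` the set of links. -/

section Problem

variable {ι : Type*} [Fintype ι]

/-- The delay of path `a` in a round with noise `x`, when the mean link delays are `μ`. -/
def pathLoss (μ : ι → ℝ) (x : ℝ) (a : ι → ℝ) : ℝ := a ⬝ᵥ μ + x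

/-- A (deterministic) routing policy: from the past selections and the observed end-to-end delays,
in chronological order, to the next path. -/
abbrev RoutingPolicy (ι : Type*) := List ((ι → ℝ) × ℝ) → (ι → ℝ)

/-- What has been selected and observed in the first `t` rounds under the policy `π`. -/
def playHistory (π : RoutingPolicy ι) (μ : ι → ℝ) (η : ℕ → ℝ) : ℕ → List ((ι → ℝ) × ℝ)
  | 0 => []
  | t + 1 => playHistory π μ η t ++
      [(π (playHistory π μ η t), pathLoss μ (η t) (π (playHistory π μ η t)))]

/-- The path selected in round `t`. -/
def selectedPath (π : RoutingPolicy ι) (μ : ι → ℝ) (η : ℕ → ℝ) (t : ℕ) : ι → ℝ :=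
  π (playHistory π μ η t)

/-- The regret after `T` rounds: the total delay incurred, minus the least total delay of a fixed
path in `A`. -/
noncomputable def routingRegret (A : Finset (ι → ℝ)) (π : RoutingPolicy ι) (μ : ι → ℝ) (T : ℕ)
    (η : ℕ → ℝ) : ℝ :=
  ∑ t ∈ Finset.range T, pathLoss μ (η t) (selectedPath π μ η t) -
    sInf ((fun a => ∑ t ∈ Finset.range T, pathLoss μ (η t) a) '' (A : Set (ι → ℝ)))

/-- The set of gaps `Δ_a = ⟨a - a⋆, μ⟩` of the paths `a ≠ a⋆`. -/
def gapSet (A : Finset (ι → ℝ)) (μ : ι → ℝ) (astar : ι → ℝ) : Set ℝ :=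
  (fun a => (a - astar) ⬝ᵥ μ) '' {a | a ∈ A ∧ a ≠ astar}

/-- The maximum gap (`0` if there is only one path). -/
noncomputable def gapMax (A : Finset (ι → ℝ)) (μ : ι → ℝ) (astar : ι → ℝ) : ℝ :=
  sSup (gapSet A μ astar)

/-- The minimum gap (`0` if there is only one path). -/
noncomputable def gapMin (A : Finset (ι → ℝ)) (μ : ι → ℝ) (astar : ι → ℝ) : ℝ :=
  sInf (gapSet A μ astar)

/-- `astar` is the unique path in `A` with the least mean delay. -/
def IsUniqueShortest (A : Finset (ι → ℝ)) (μ : ι → ℝ) (astar : ι → ℝ) : Prop :=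
  astar ∈ A ∧ ∀ a ∈ A, a ≠ astar → astar ⬝ᵥ μ < a ⬝ᵥ μ

variable {Ω : Type*}

/-- The sigma-algebra generated by the selected paths and the noise terms of the rounds before
`t`. -/
@[reducible] def historySigma (I : ℕ → Ω → ι → ℝ) (η : ℕ → Ω → ℝ) (t : ℕ) : MeasurableSpace Ω :=
  ⨆ s : Fin t, (MeasurableSpace.comap (I s) inferInstance ⊔
    MeasurableSpace.comap (η s) inferInstance)

/-- Given the past selections and the past noise, the noise `η t` of every round `t < T` has mean
zero and is `R`-sub-Gaussian. -/
structure IsCondSubGaussianNoise [MeasurableSpace Ω] (P : Measure Ω) (R : ℝ) (T : ℕ)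
    (I : ℕ → Ω → ι → ℝ) (η : ℕ → Ω → ℝ) : Prop where
  measurable : ∀ t < T, Measurable (η t)
  integrable_exp : ∀ t < T, ∀ α : ℝ, Integrable (fun ω => Real.exp (α * η t ω)) P
  condExp_exp_le : ∀ t < T, ∀ α : ℝ,
    P[fun ω => Real.exp (α * η t ω) | historySigma I η t] ≤ᵐ[P]
      fun _ => Real.exp (α ^ 2 * R ^ 2 / 2)
  condExp_eq_zero : ∀ t < T, P[η t | historySigma I η t] =ᵐ[P] 0

end Problem

/-! ### The Top-Two Comparison algorithm -/

/-- A way to compute `argmin_{a ∈ F} ⟨a, ψ⟩`; where the minimizer is not unique, any (measurable)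
rule for breaking ties is allowed. -/
structure ArgminRule (ι : Type*) [Fintype ι] where
  pick : Finset (ι → ℝ) → (ι → ℝ) → (ι → ℝ)
  pick_mem : ∀ F : Finset (ι → ℝ), F.Nonempty → ∀ ψ, pick F ψ ∈ F
  pick_le : ∀ F : Finset (ι → ℝ), F.Nonempty → ∀ ψ, ∀ a ∈ F, pick F ψ ⬝ᵥ ψ ≤ a ⬝ᵥ ψ
  measurable_pick : ∀ F : Finset (ι → ℝ), F.Nonempty → Measurable (pick F)

/-- The input of the algorithm. It contains neither the mean delays nor the gaps. -/
structure TTCInput (ι : Type*) [Fintype ι] where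
  /-- the set of paths -/
  paths : Finset (ι → ℝ)
  /-- the exploration basis, with as many paths as there are links -/
  basis : Fin (Fintype.card ι) → ι → ℝ
  /-- the approximation factor of the basis -/
  S : ℝ
  /-- the sub-Gaussian parameter of the noise -/
  R : ℝ
  /-- the time horizon -/
  T : ℕ
  /-- the rule for computing shortest paths -/
  argmin : ArgminRule ι

namespace TTCInput

variable {ι : Type*} [Fintype ι] (X : TTCInput ι)

/-- The confidence width `Δ̃_m = S R √((2 ln(2) d² + 8 d ln T) / m)`. -/
noncomputable def width (m : ℕ) : ℝ :=
  X.S * X.R * √((2 * Real.log 2 * (Fintype.card ι : ℝ) ^ 2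
    + 8 * (Fintype.card ι : ℝ) * Real.log X.T) / m)

/-- The design matrix: row `i` is the path selected in round `i`, for the first `n` rounds. -/
def design (h : List ((ι → ℝ) × ℝ)) (n : ℕ) : Matrix (Fin n) ι ℝ :=
  Matrix.of fun i => (h.getD i (0, 0)).1

/-- The response vector: the delays observed in the first `n` rounds. -/
def response (h : List ((ι → ℝ) × ℝ)) (n : ℕ) : Fin n → ℝ :=
  fun i => (h.getD i (0, 0)).2

open Classical in
/-- The ordinary least squares estimate `μ̂_m = (DᵀD)⁻¹ Dᵀ r` after `m` epochs of exploration,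
that is, from the first `m d` rounds. -/
noncomputable def estimate (h : List ((ι → ℝ) × ℝ)) (m : ℕ) : ι → ℝ :=
  ((design h (m * Fintype.card ι))ᵀ * design h (m * Fintype.card ι))⁻¹ *ᵥ
    ((design h (m * Fintype.card ι))ᵀ *ᵥ response h (m * Fintype.card ι))

/-- The estimated shortest path in `F` at the end of epoch `m`. -/
noncomputable def shortest (h : List ((ι → ℝ) × ℝ)) (F : Finset (ι → ℝ)) (m : ℕ) : ι → ℝ :=
  X.argmin.pick F (estimate h m)

open Classical in
/-- The estimated second shortest path in `F` at the end of epoch `m`. -/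
noncomputable def secondShortest (h : List ((ι → ℝ) × ℝ)) (F : Finset (ι → ℝ)) (m : ℕ) : ι → ℝ :=
  X.argmin.pick (F.erase (X.shortest h F m)) (estimate h m)

/-- The estimated gap between the two exceeds `2 Δ̃_m`. -/
def Separated (h : List ((ι → ℝ) × ℝ)) (F : Finset (ι → ℝ)) (m : ℕ) : Prop :=
  2 * X.width m < X.secondShortest h F m ⬝ᵥ estimate h m - X.shortest h F m ⬝ᵥ estimate h m

open Classical in
/-- `X.remaining h m` is the set of the paths that remain after `m` epochs, when the history is
`h`. Epoch `m + 1` changes nothing if only one path is left; otherwise it keeps only the estimated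
shortest path if the top two are separated, and keeps all paths if they are not. -/
noncomputable def remaining (h : List ((ι → ℝ) × ℝ)) : ℕ → Finset (ι → ℝ)
  | 0 => X.paths
  | m + 1 =>
    if (remaining h m).card = 1 then remaining h m
    else if X.Separated h (remaining h m) (m + 1) then {X.shortest h (remaining h m) (m + 1)}
    else remaining h m

open Classical in
/-- The Top-Two Comparison algorithm. An epoch of exploration takes `d` rounds, one for each path
of the basis, and all epochs of exploration come first; so, as long as more than one path remains,
round `t` belongs to the epoch that follows the first `t / d` ones. Once a single path remains, it
is selected forever. (The last case does not occur.) -/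
noncomputable def policy : RoutingPolicy ι := fun h =>
  if hF : ∃ a, X.remaining h (h.length / Fintype.card ι) = {a} then hF.choose
  else if hd : 0 < Fintype.card ι then X.basis ⟨h.length % Fintype.card ι, Nat.mod_lt _ hd⟩
  else 0

end TTCInput

/-- The number of epochs `m̄ = S² R² (32 ln(2) d² + 128 d ln T) / Δ_min²`. -/
noncomputable def epochBound (S R : ℝ) (d T : ℕ) (Δmin : ℝ) : ℝ :=
  S ^ 2 * R ^ 2 * (32 * Real.log 2 * (d : ℝ) ^ 2 + 128 * (d : ℝ) * Real.log T) / Δmin ^ 2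

/-! ### Regret as a sum of gaps. -/

section Histories

variable {ι : Type*} [Fintype ι]

/-! The noise of a round is common to all paths, so the regret is a sum of gaps, and it suffices to
count the rounds before the optimal path is isolated.

The data are adaptive only in appearance: until a single path remains, the algorithm cycles through
the basis, so every estimate that matters comes from a deterministic design
(`remaining_playHistory`). For `a = ∑ νᵢ bᵢ`, the estimation error of `⟨a, μ⟩` after `m` epochs is
then the sum of the noise terms with fixed weights `νᵢ / m` (`dotProduct_explorationEstimate`). It
is sub-Gaussian with variance proxy `d S² R² / m`, and exceeds the width with probability at most `2
· 2⁻ᵈ T⁻⁴`. A union bound over at most `2ᵈ` paths and `T / d` epochs gives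
`measureReal_inaccurate_le`.

Off this event an elimination can only keep the optimal path, and one must have occurred once `4
Δ̃_m < Δ_min`, that is, once `m > m̄` (`epochStep_eq_of_separated`, `four_mul_width_lt`). So at most
`(m̄ + 1) d` rounds cost anything. The bad event adds at most `d Δ_max` in expectation, and `Δ_min ≤
d` absorbs such terms into the stated rate. -/

theorem length_playHistory (π : RoutingPolicy ι) (μ : ι → ℝ) (η : ℕ → ℝ) (t : ℕ) :
    (playHistory π μ η t).length = t := by
  induction t with
  | zero => rfl
  | succ t ih => simp [playHistory, ih]

theorem getD_playHistory (π : RoutingPolicy ι) (μ : ι → ℝ) (η : ℕ → ℝ) {k t : ℕ} (hk : k < t) :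
    (playHistory π μ η t).getD k (0, 0) =
      (selectedPath π μ η k, pathLoss μ (η k) (selectedPath π μ η k)) := by
  induction t with
  | zero => omega
  | succ t ih =>
    rw [playHistory]
    rcases Nat.lt_succ_iff_lt_or_eq.mp hk with h | rfl
    · rw [List.getD_append _ _ _ _ (by rwa [length_playHistory]), ih h]
    · rw [List.getD_append_right _ _ _ _ (by rw [length_playHistory]), length_playHistory]
      simp [selectedPath]

/-- The noise is common to all paths, so it cancels in the regret. -/
theorem routingRegret_eq_sum_gap {A : Finset (ι → ℝ)} {μ astar : ι → ℝ}
    (h : IsUniqueShortest A μ astar) (π : RoutingPolicy ι) (T : ℕ) (η : ℕ → ℝ) :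
    routingRegret A π μ T η =
      ∑ t ∈ Finset.range T, (selectedPath π μ η t - astar) ⬝ᵥ μ := by
  have hl : IsLeast ((fun a => ∑ t ∈ Finset.range T, pathLoss μ (η t) a) '' (A : Set (ι → ℝ)))
      (∑ t ∈ Finset.range T, pathLoss μ (η t) astar) := by
    refine ⟨⟨astar, h.1, rfl⟩, ?_⟩
    rintro _ ⟨a, ha, rfl⟩
    refine Finset.sum_le_sum fun t _ => ?_
    by_cases hne : a = astar
    · rw [hne]
    · simpa [pathLoss] using (h.2 a ha hne).le
  rw [routingRegret, hl.csInf_eq, ← Finset.sum_sub_distrib]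
  refine Finset.sum_congr rfl fun t _ => ?_
  simp [pathLoss, sub_dotProduct]

theorem gapSet_finite (A : Finset (ι → ℝ)) (μ astar : ι → ℝ) : (gapSet A μ astar).Finite :=
  (A.finite_toSet.subset fun _ h => h.1).image _

theorem gap_le_gapMax {A : Finset (ι → ℝ)} {μ astar a : ι → ℝ} (ha : a ∈ A) (hne : a ≠ astar) :
    (a - astar) ⬝ᵥ μ ≤ gapMax A μ astar :=
  le_csSup (gapSet_finite A μ astar).bddAbove ⟨a, ⟨ha, hne⟩, rfl⟩

theorem gapMin_le_gap {A : Finset (ι → ℝ)} {μ astar a : ι → ℝ} (ha : a ∈ A) (hne : a ≠ astar) :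
    gapMin A μ astar ≤ (a - astar) ⬝ᵥ μ :=
  csInf_le (gapSet_finite A μ astar).bddBelow ⟨a, ⟨ha, hne⟩, rfl⟩

theorem gapMax_nonneg {A : Finset (ι → ℝ)} {μ astar : ι → ℝ} (h : IsUniqueShortest A μ astar) :
    0 ≤ gapMax A μ astar := by
  refine Real.sSup_nonneg ?_
  rintro _ ⟨a, ha, rfl⟩
  simpa [sub_dotProduct] using (h.2 a ha.1 ha.2).le

theorem gap_mem_Icc {A : Finset (ι → ℝ)} {μ astar a : ι → ℝ} (h : IsUniqueShortest A μ astar)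
    (ha : a ∈ A) : (a - astar) ⬝ᵥ μ ∈ Set.Icc 0 (gapMax A μ astar) := by
  by_cases hne : a = astar
  · simpa [hne] using gapMax_nonneg h
  · exact ⟨by simpa [sub_dotProduct] using (h.2 a ha hne).le, gap_le_gapMax ha hne⟩

theorem gapMin_pos {A : Finset (ι → ℝ)} {μ astar : ι → ℝ} (h : IsUniqueShortest A μ astar)
    (hA : A.card ≠ 1) : 0 < gapMin A μ astar := by
  have hne : (gapSet A μ astar).Nonempty := by
    obtain ⟨a, ha, hane⟩ := A.exists_mem_ne
      (lt_of_le_of_ne (Finset.card_pos.mpr ⟨_, h.1⟩) hA.symm) astar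
    exact ⟨_, a, ⟨ha, hane⟩, rfl⟩
  obtain ⟨a, ha, he⟩ := hne.csInf_mem (gapSet_finite A μ astar)
  rw [gapMin, ← he]
  simpa [sub_dotProduct] using h.2 a ha.1 ha.2

end Histories

/-! ### Reduction of the adaptive algorithm to pure exploration. -/

namespace TTCInput

variable {ι : Type*} [Fintype ι] (X : TTCInput ι)

open Classical in
/-- What epoch `m` does to the set `F` of remaining paths, when the estimate is `ψ`. -/
noncomputable def epochStep (m : ℕ) (F : Finset (ι → ℝ)) (ψ : ι → ℝ) : Finset (ι → ℝ) :=
  if F.card = 1 then F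
  else if 2 * X.width m <
    X.argmin.pick (F.erase (X.argmin.pick F ψ)) ψ ⬝ᵥ ψ - X.argmin.pick F ψ ⬝ᵥ ψ then
    {X.argmin.pick F ψ}
  else F

/-- The paths that remain after each epoch, when the estimates are given by `ψ`. -/
noncomputable def survivors (ψ : ℕ → ι → ℝ) : ℕ → Finset (ι → ℝ)
  | 0 => X.paths
  | m + 1 => X.epochStep (m + 1) (survivors ψ m) (ψ (m + 1))

theorem remaining_succ (h : List ((ι → ℝ) × ℝ)) (m : ℕ) :
    X.remaining h (m + 1) = X.epochStep (m + 1) (X.remaining h m) (estimate h (m + 1)) := by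
  simp only [remaining, epochStep, Separated, shortest, secondShortest]
  congr

/-- The path that an epoch of exploration selects in round `k`. -/
noncomputable def exploration (k : ℕ) : ι → ℝ :=
  if hd : 0 < Fintype.card ι then X.basis ⟨k % Fintype.card ι, Nat.mod_lt _ hd⟩ else 0

/-- The history of `n` rounds of exploration. -/
noncomputable def explorationHistory (μ : ι → ℝ) (x : ℕ → ℝ) (n : ℕ) : List ((ι → ℝ) × ℝ) :=
  (List.range n).map fun k => (X.exploration k, pathLoss μ (x k) (X.exploration k))

/-- The least squares estimate after `m` epochs of pure exploration. -/
noncomputable def explorationEstimate (μ : ι → ℝ) (x : ℕ → ℝ) (m : ℕ) : ι → ℝ :=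
  estimate (X.explorationHistory μ x (m * Fintype.card ι)) m

theorem getD_explorationHistory (μ : ι → ℝ) (x : ℕ → ℝ) {k n : ℕ} (hk : k < n) :
    (X.explorationHistory μ x n).getD k (0, 0) =
      (X.exploration k, pathLoss μ (x k) (X.exploration k)) := by
  simp [explorationHistory, List.getD, hk]

/-- This allows the real history to be replaced by the exploration history wherever the two agree on
the first `m` epochs. -/
theorem estimate_congr {h h' : List ((ι → ℝ) × ℝ)} {m : ℕ}
    (H : ∀ k < m * Fintype.card ι, h.getD k (0, 0) = h'.getD k (0, 0)) :
    estimate h m = estimate h' m := by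
  have h1 : design h (m * Fintype.card ι) = design h' (m * Fintype.card ι) := by
    ext i j
    simp only [design, Matrix.of_apply, H i i.2]
  have h2 : response h (m * Fintype.card ι) = response h' (m * Fintype.card ι) := by
    ext i
    simp only [response, H i i.2]
  rw [estimate, estimate, h1, h2]

theorem epochStep_of_card_eq_one {m : ℕ} {F : Finset (ι → ℝ)} (hF : F.card = 1) (ψ : ι → ℝ) :
    X.epochStep m F ψ = F := if_pos hF

theorem survivors_card_eq_one {ψ : ℕ → ι → ℝ} {m n : ℕ} (hmn : m ≤ n)
    (h : (X.survivors ψ m).card = 1) : X.survivors ψ n = X.survivors ψ m := by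
  induction n, hmn using Nat.le_induction with
  | base => rfl
  | succ n _ ih => rw [survivors, epochStep_of_card_eq_one _ (by rw [ih, h]), ih]

theorem policy_eq (h : List ((ι → ℝ) × ℝ)) :
    (∃ a, X.remaining h (h.length / Fintype.card ι) = {a} ∧ X.policy h = a) ∨
      (X.remaining h (h.length / Fintype.card ι)).card ≠ 1 ∧
        X.policy h = X.exploration h.length := by
  by_cases hF : ∃ a, X.remaining h (h.length / Fintype.card ι) = {a}
  · refine Or.inl ⟨hF.choose, hF.choose_spec, ?_⟩
    simp only [policy, dif_pos hF]
  · refine Or.inr ⟨fun h1 => hF (Finset.card_eq_one.mp h1), ?_⟩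
    simp only [policy, dif_neg hF, exploration]

theorem selectedPath_of_card_ne_one {μ : ι → ℝ} {x : ℕ → ℝ} {k : ℕ}
    (h : (X.remaining (playHistory X.policy μ x k) (k / Fintype.card ι)).card ≠ 1) :
    selectedPath X.policy μ x k = X.exploration k := by
  have := X.policy_eq (playHistory X.policy μ x k)
  rw [length_playHistory] at this
  rcases this with ⟨a, ha, -⟩ | ⟨-, h2⟩
  · exact absurd (by rw [ha]; simp) h
  · exact h2

theorem selectedPath_of_eq_singleton {μ : ι → ℝ} {x : ℕ → ℝ} {k : ℕ} {a : ι → ℝ}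
    (h : X.remaining (playHistory X.policy μ x k) (k / Fintype.card ι) = {a}) :
    selectedPath X.policy μ x k = a := by
  have := X.policy_eq (playHistory X.policy μ x k)
  rw [length_playHistory] at this
  rcases this with ⟨a', ha', h2⟩ | ⟨h1, -⟩
  · rw [h, Finset.singleton_inj] at ha'
    rw [ha']
    exact h2
  · exact absurd (by rw [h]; simp) h1

/-- As long as decisions matter, the algorithm has only explored; hence the remaining paths are
those that it would keep if it explored forever. -/
theorem remaining_playHistory (μ : ι → ℝ) (x : ℕ → ℝ) (m : ℕ) :
    ∀ t, m * Fintype.card ι ≤ t → X.remaining (playHistory X.policy μ x t) m =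
      X.survivors (X.explorationEstimate μ x) m := by
  induction m using Nat.strong_induction_on with
  | _ m ih =>
    intro t ht
    cases m with
    | zero => rfl
    | succ m =>
      have hm := ih m (Nat.lt_succ_self m) t (le_trans (by gcongr; omega) ht)
      rw [remaining_succ, hm, survivors]
      by_cases h1 : (X.survivors (X.explorationEstimate μ x) m).card = 1
      · rw [epochStep_of_card_eq_one _ h1, epochStep_of_card_eq_one _ h1]
      · congr 1
        refine estimate_congr fun k hk => ?_
        rw [getD_playHistory _ _ _ (hk.trans_le ht), getD_explorationHistory _ _ _ hk]
        have hkm : k / Fintype.card ι < m + 1 :=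
          Nat.div_lt_of_lt_mul (by rwa [mul_comm] at hk)
        have hk' := ih _ hkm k (Nat.div_mul_le_self _ _)
        -- Round `k` lies in an epoch that starts with at least as many paths as epoch `m + 1`; a
        -- singleton there would have persisted, against `h1`.
        rw [X.selectedPath_of_card_ne_one]
        rw [hk']
        intro h2
        exact h1 (by rw [X.survivors_card_eq_one (Nat.lt_succ_iff.mp hkm) h2, h2])

/-- Elimination is all or nothing, so the state never becomes empty and only a single nontrivial
argmin problem, over all paths, has to be analysed. -/
theorem survivors_eq_or (ψ : ℕ → ι → ℝ) (h0 : X.paths.Nonempty) (m : ℕ) :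
    X.survivors ψ m = X.paths ∨ ∃ a ∈ X.paths, X.survivors ψ m = {a} := by
  induction m with
  | zero => exact Or.inl rfl
  | succ m ih =>
    rw [survivors, epochStep]
    split_ifs with h1 h2
    · exact ih
    · refine Or.inr ⟨_, ?_, rfl⟩
      rcases ih with h | ⟨a, ha, h⟩
      · rw [h]; exact X.argmin.pick_mem _ h0 _
      · simp [h] at h1
    · exact ih

theorem selectedPath_mem (h0 : X.paths.Nonempty) (hb : ∀ i, X.basis i ∈ X.paths)
    (hd : 0 < Fintype.card ι) (μ : ι → ℝ) (x : ℕ → ℝ) (t : ℕ) :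
    selectedPath X.policy μ x t ∈ X.paths := by
  by_cases h : (X.remaining (playHistory X.policy μ x t) (t / Fintype.card ι)).card = 1
  · obtain ⟨a, ha⟩ := Finset.card_eq_one.mp h
    rw [X.selectedPath_of_eq_singleton ha]
    rw [X.remaining_playHistory _ _ _ _ (Nat.div_mul_le_self _ _)] at ha
    rcases X.survivors_eq_or (X.explorationEstimate μ x) h0 (t / Fintype.card ι)
      with h | ⟨a', ha', h⟩
    · rw [← h, ha]; simp
    · rw [ha, Finset.singleton_inj] at h
      rwa [h]
  · rw [X.selectedPath_of_card_ne_one h, exploration, dif_pos hd]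
    exact hb _

/-! ### Decisions made from accurate estimates. -/

section GoodEstimates

variable {X} {μ astar : ι → ℝ}

/-- If the estimates of all path delays are accurate and the top two paths are separated, then
exactly the shortest path survives. -/
theorem epochStep_eq_of_separated (hs : IsUniqueShortest X.paths μ astar) (hc : X.paths.card ≠ 1)
    {m : ℕ} {ψ : ι → ℝ} (hψ : ∀ a ∈ X.paths, |a ⬝ᵥ ψ - a ⬝ᵥ μ| ≤ X.width m) :
    X.epochStep m X.paths ψ = {astar} ∨ X.epochStep m X.paths ψ = X.paths ∧
      ¬ (4 * X.width m < gapMin X.paths μ astar) := by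
  classical
  have h0 : X.paths.Nonempty := ⟨_, hs.1⟩
  have hne : (X.paths.erase (X.argmin.pick X.paths ψ)).Nonempty := by
    rw [← Finset.card_pos, Finset.card_erase_of_mem (X.argmin.pick_mem _ h0 _)]
    have := Finset.card_pos.mpr h0
    omega
  have hmem := X.argmin.pick_mem _ hne ψ
  have hp := X.argmin.pick_mem _ h0 ψ
  have hle := X.argmin.pick_le _ h0 ψ
  have hle' := X.argmin.pick_le _ hne ψ
  rw [epochStep, if_neg hc]
  convert_to (if 2 * X.width m < X.argmin.pick (X.paths.erase (X.argmin.pick X.paths ψ)) ψ ⬝ᵥ ψ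
      - X.argmin.pick X.paths ψ ⬝ᵥ ψ then {X.argmin.pick X.paths ψ} else X.paths) = {astar} ∨
    (if 2 * X.width m < X.argmin.pick (X.paths.erase (X.argmin.pick X.paths ψ)) ψ ⬝ᵥ ψ
      - X.argmin.pick X.paths ψ ⬝ᵥ ψ then {X.argmin.pick X.paths ψ} else X.paths) = X.paths ∧ _
  split_ifs with h
  · left
    rw [Finset.singleton_inj]
    -- A wrong choice leaves `astar` among the competitors, so the estimated gap is at most `2 Δ̃_m`
    -- minus a positive true gap, and the test fails.
    by_contra hx
    have h1 := hle' astar (Finset.mem_erase.mpr ⟨Ne.symm hx, hs.1⟩)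
    have h2 := hs.2 _ hp hx
    have h3 := abs_le.mp (hψ _ hs.1)
    have h4 := abs_le.mp (hψ _ hp)
    linarith
  · right
    refine ⟨rfl, fun hw => h ?_⟩
    -- Estimation changes a gap by at most `2 Δ̃_m`. Since every gap exceeds `4 Δ̃_m`, the order
    -- relative to `astar` is preserved and the estimated gap still exceeds `2 Δ̃_m`.
    have hstar : X.argmin.pick X.paths ψ = astar := by
      by_contra hx
      have h1 := hle astar hs.1
      have h2 := gapMin_le_gap (μ := μ) hp hx
      have h3 := abs_le.mp (hψ _ hs.1)
      have h4 := abs_le.mp (hψ _ hp)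
      rw [sub_dotProduct] at h2
      have := (abs_nonneg _).trans (hψ _ hs.1)
      linarith
    have h5 := Finset.mem_erase.mp hmem
    have h2 := gapMin_le_gap (μ := μ) h5.2
      (fun e => h5.1 (e.trans hstar.symm))
    have h3 := abs_le.mp (hψ _ hp)
    have h4 := abs_le.mp (hψ _ h5.2)
    rw [sub_dotProduct, ← hstar] at h2
    rw [← hstar] at hw
    linarith

theorem survivors_eq_of_accurate (hs : IsUniqueShortest X.paths μ astar)
    (hc : X.paths.card ≠ 1) {ψ : ℕ → ι → ℝ} {M : ℕ}
    (hψ : ∀ m, 1 ≤ m → m ≤ M → ∀ a ∈ X.paths, |a ⬝ᵥ ψ m - a ⬝ᵥ μ| ≤ X.width m)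
    {m : ℕ} (hm : m ≤ M) :
    X.survivors ψ m = X.paths ∨ X.survivors ψ m = {astar} := by
  induction m with
  | zero => exact Or.inl rfl
  | succ m ih =>
    rw [survivors]
    rcases ih (by omega) with h | h
    · rw [h]
      rcases epochStep_eq_of_separated hs hc (hψ (m + 1) (by omega) hm) with h' | ⟨h', -⟩
      · exact Or.inr h'
      · exact Or.inl h'
    · rw [h, epochStep_of_card_eq_one _ (by simp)]
      exact Or.inr rfl

/-- One epoch `k` with a small width suffices, because a singleton is never changed afterwards. -/
theorem survivors_eq_singleton_of_width_lt (hs : IsUniqueShortest X.paths μ astar)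
    (hc : X.paths.card ≠ 1) {ψ : ℕ → ι → ℝ} {M : ℕ}
    (hψ : ∀ m, 1 ≤ m → m ≤ M → ∀ a ∈ X.paths, |a ⬝ᵥ ψ m - a ⬝ᵥ μ| ≤ X.width m)
    {k m : ℕ} (hk : 1 ≤ k) (hkm : k ≤ m) (hm : m ≤ M)
    (hw : 4 * X.width k < gapMin X.paths μ astar) :
    X.survivors ψ m = {astar} := by
  have hk' : X.survivors ψ k = {astar} := by
    obtain ⟨j, rfl⟩ : ∃ j, k = j + 1 := ⟨k - 1, by omega⟩
    rw [survivors]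
    rcases survivors_eq_of_accurate hs hc hψ (m := j) (by omega) with h | h
    · rw [h]
      rcases epochStep_eq_of_separated hs hc (hψ (j + 1) hk (by omega)) with h' | ⟨-, h'⟩
      · exact h'
      · exact absurd hw h'
    · rw [h, epochStep_of_card_eq_one _ (by simp)]
  rw [X.survivors_card_eq_one hkm (by rw [hk']; simp), hk']

end GoodEstimates

end TTCInput

namespace TTCInput

variable {ι : Type*} [Fintype ι] (X : TTCInput ι)

/-! ### The least squares error on the exploration design. -/

section LeastSquares

theorem exploration_add_mul (hd : 0 < Fintype.card ι) (i : Fin (Fintype.card ι)) (j : ℕ) :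
    X.exploration (i + Fintype.card ι * j) = X.basis i := by
  rw [exploration, dif_pos hd]
  congr 1
  ext
  simp [Nat.mod_eq_of_lt i.2]

theorem design_explorationHistory (μ : ι → ℝ) (x : ℕ → ℝ) (n : ℕ) :
    design (X.explorationHistory μ x n) n = Matrix.of fun k : Fin n => X.exploration k := by
  ext k e
  simp only [design, Matrix.of_apply, X.getD_explorationHistory μ x k.2]

theorem response_explorationHistory (μ : ι → ℝ) (x : ℕ → ℝ) (n : ℕ) :
    response (X.explorationHistory μ x n) n =
      design (X.explorationHistory μ x n) n *ᵥ μ + fun k : Fin n => x k := by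
  ext k
  rw [design_explorationHistory]
  simp only [response, X.getD_explorationHistory μ x k.2, pathLoss, Pi.add_apply]
  rfl

theorem sum_range_mul_eq_sum_sum {β : Type*} [AddCommMonoid β] (m n : ℕ) (f : ℕ → β) :
    ∑ k ∈ Finset.range (m * n), f k = ∑ i : Fin n, ∑ j : Fin m, f (i + n * j) := by
  rw [Finset.sum_range, ← finProdFinEquiv.sum_comp, Fintype.sum_prod_type_right]
  simp [finProdFinEquiv]

/-- The error of the least squares estimate of the delay of a path is a fixed linear combination
of the noise terms. -/
theorem dotProduct_explorationEstimate (hd : 0 < Fintype.card ι)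
    (hli : LinearIndependent ℝ X.basis) (μ : ι → ℝ) (x : ℕ → ℝ) {m : ℕ} (hm : 0 < m)
    {a : ι → ℝ} {ν : Fin (Fintype.card ι) → ℝ} (ha : a = ∑ i, ν i • X.basis i) :
    a ⬝ᵥ X.explorationEstimate μ x m - a ⬝ᵥ μ =
      ∑ k ∈ Finset.range (m * Fintype.card ι),
        ν ⟨k % Fintype.card ι, Nat.mod_lt _ hd⟩ / m * x k := by
  classical
  have hspan : Submodule.span ℝ (Set.range X.basis) = ⊤ :=
    hli.span_eq_top_of_card_eq_finrank' (by simp)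
  set n := m * Fintype.card ι with hn
  set D := design (X.explorationHistory μ x n) n with hD
  have hDk : ∀ k : Fin n, D k = X.exploration k := fun k => by
    rw [hD, design_explorationHistory]; rfl
  -- `DᵀD` and `D` have the same kernel, and the first `d` rows of `D` are the basis because `m >
  -- 0`.
  have hunit : IsUnit (Dᵀ * D) := by
    refine Matrix.mulVec_injective_iff_isUnit.mp ?_
    refine (injective_iff_map_eq_zero (Matrix.mulVecLin (Dᵀ * D))).mpr fun v hv => ?_
    have hv' : v ∈ LinearMap.ker (Matrix.mulVecLin (Dᵀ * D)) := hv
    rw [Matrix.ker_mulVecLin_transpose_mul_self, LinearMap.mem_ker, Matrix.mulVecLin_apply] at hv'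
    have hb : ∀ i, X.basis i ⬝ᵥ v = 0 := fun i => by
      have h1 := congrFun hv' ⟨i, i.2.trans_le (Nat.le_mul_of_pos_left _ hm)⟩
      have h2 := X.exploration_add_mul hd i 0
      rw [mul_zero, add_zero] at h2
      rw [Matrix.mulVec, hDk] at h1
      simpa [h2] using h1
    have hall : ∀ w : ι → ℝ, w ⬝ᵥ v = 0 := fun w => by
      have hw : w ∈ Submodule.span ℝ (Set.range X.basis) := hspan ▸ Submodule.mem_top
      induction hw using Submodule.span_induction with
      | mem w hw => obtain ⟨i, rfl⟩ := hw; exact hb i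
      | zero => simp
      | add w w' _ _ h h' => rw [add_dotProduct, h, h', add_zero]
      | smul c w _ h => rw [smul_dotProduct, h, smul_zero]
    exact dotProduct_self_eq_zero.mp (hall v)
  set z := X.explorationEstimate μ x m - μ with hz
  have hnormal : (Dᵀ * D) *ᵥ z = Dᵀ *ᵥ fun k : Fin n => x k := by
    have : X.explorationEstimate μ x m = (Dᵀ * D)⁻¹ *ᵥ
        (Dᵀ *ᵥ response (X.explorationHistory μ x n) n) := by
      rw [explorationEstimate, estimate]
    rw [hz, this, Matrix.mulVec_sub, Matrix.mulVec_mulVec,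
      Matrix.mul_nonsing_inv _ ((Matrix.isUnit_iff_isUnit_det _).mp hunit), Matrix.one_mulVec,
      response_explorationHistory, Matrix.mulVec_add, Matrix.mulVec_mulVec, add_sub_cancel_left]
  -- The normal equations, read as a linear relation between the rows. Grouped by basis vector,
  -- independence makes each coefficient vanish, so `⟨bᵢ, z⟩` is the average noise over the rounds
  -- of `bᵢ`.
  have hsum : ∑ k ∈ Finset.range n, (X.exploration k ⬝ᵥ z - x k) • X.exploration k = 0 := by
    rw [← sub_eq_zero, ← Matrix.mulVec_mulVec, ← Matrix.mulVec_sub] at hnormal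
    rw [Finset.sum_range, ← hnormal]
    ext e
    simp only [Finset.sum_apply, Pi.smul_apply, smul_eq_mul, Matrix.mulVec, dotProduct,
      Matrix.transpose_apply, Pi.sub_apply, hDk]
    exact Finset.sum_congr rfl fun k _ => mul_comm _ _
  rw [hn, sum_range_mul_eq_sum_sum] at hsum
  simp only [X.exploration_add_mul hd, ← Finset.sum_smul] at hsum
  have hcoef : ∀ i, X.basis i ⬝ᵥ z = (∑ j : Fin m, x (i + Fintype.card ι * j)) / m := fun i => by
    have h := Fintype.linearIndependent_iff.mp hli _ hsum i
    rw [Finset.sum_sub_distrib, Finset.sum_const, Finset.card_univ, Fintype.card_fin,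
      nsmul_eq_mul] at h
    rw [eq_div_iff (by positivity)]
    linarith
  rw [← dotProduct_sub, ← hz, ha, sum_dotProduct, hn, sum_range_mul_eq_sum_sum]
  refine Finset.sum_congr rfl fun i _ => ?_
  rw [smul_dotProduct, hcoef, smul_eq_mul, Finset.sum_div, Finset.mul_sum]
  refine Finset.sum_congr rfl fun j _ => ?_
  have : (⟨(i + Fintype.card ι * j) % Fintype.card ι, Nat.mod_lt _ hd⟩ : Fin (Fintype.card ι))
      = i := by
    ext
    simp [Nat.mod_eq_of_lt i.2]
  rw [this]
  ring

end LeastSquares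

end TTCInput

/-! ### Measurability of the algorithm's choices. -/

section Measurability

variable {Ω : Type*} [MeasurableSpace Ω]

/-- An argmin rule is measurable only for a fixed set, while the algorithm applies it to random
sets. Splitting over their finitely many values freezes the set. -/
theorem measurableSet_setOf_of_finite_range {α : Type*} {F : Ω → α} {s : Set α} (hs : s.Finite)
    (hF : ∀ ω, F ω ∈ s) (hm : ∀ a ∈ s, MeasurableSet {ω | F ω = a}) {Q : α → Ω → Prop}
    (hQ : ∀ a ∈ s, MeasurableSet {ω | Q a ω}) : MeasurableSet {ω | Q (F ω) ω} := by
  have : {ω | Q (F ω) ω} = ⋃ a ∈ s, {ω | F ω = a} ∩ {ω | Q a ω} := by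
    ext ω
    simp only [Set.mem_ofPred_eq, Set.mem_iUnion, Set.mem_inter_iff, exists_prop]
    exact ⟨fun h => ⟨_, hF ω, rfl, h⟩, fun ⟨a, _, h, h'⟩ => h ▸ h'⟩
  rw [this]
  exact hs.measurableSet_biUnion fun a ha => (hm a ha).inter (hQ a ha)

theorem measurableSet_ite_eq {α : Type*} {p : Ω → Prop} [DecidablePred p]
    (hp : MeasurableSet {ω | p ω}) (a b c : α) :
    MeasurableSet {ω | (if p ω then a else b) = c} := by
  have : {ω | (if p ω then a else b) = c} =
      {ω | p ω} ∩ {_ω | a = c} ∪ {ω | p ω}ᶜ ∩ {_ω | b = c} := by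
    ext ω
    by_cases h : p ω <;> simp [h]
  rw [this]
  exact (hp.inter (.const _)).union (hp.compl.inter (.const _))

theorem Measurable.dotProduct {ι : Type*} [Fintype ι] {f g : Ω → ι → ℝ} (hf : Measurable f)
    (hg : Measurable g) : Measurable fun ω => f ω ⬝ᵥ g ω := by
  simp only [_root_.dotProduct]
  fun_prop

end Measurability

namespace TTCInput

variable {ι : Type*} [Fintype ι] (X : TTCInput ι) {Ω : Type*} [MeasurableSpace Ω]

theorem measurableSet_epochStep_eq (m : ℕ) {F : Finset (ι → ℝ)} (hF : F.Nonempty)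
    (G : Finset (ι → ℝ)) : MeasurableSet {ψ | X.epochStep m F ψ = G} := by
  classical
  by_cases h1 : F.card = 1
  · simp only [epochStep, if_pos h1]
    exact .const _
  simp only [epochStep, if_neg h1]
  have hpick := X.argmin.measurable_pick F hF
  refine measurableSet_setOf_of_finite_range
    (Q := fun g ψ => (if 2 * X.width m < X.argmin.pick (F.erase g) ψ ⬝ᵥ ψ - g ⬝ᵥ ψ then {g}
      else F) = G) F.finite_toSet (fun ψ => X.argmin.pick_mem F hF ψ)
    (fun g _ => hpick (measurableSet_singleton g)) fun g hg => ?_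
  have hne : (F.erase g).Nonempty := by
    rw [← Finset.card_pos, Finset.card_erase_of_mem hg]
    have := Finset.card_pos.mpr hF
    omega
  refine measurableSet_ite_eq (measurableSet_lt measurable_const ?_) _ _ _
  exact ((X.argmin.measurable_pick _ hne).dotProduct measurable_id).sub
    (measurable_const.dotProduct measurable_id)

theorem survivors_mem (ψ : ℕ → ι → ℝ) (h0 : X.paths.Nonempty) (m : ℕ) :
    X.survivors ψ m ∈ {F | F ∈ X.paths.powerset ∧ F.Nonempty} := by
  rcases X.survivors_eq_or ψ h0 m with h | ⟨a, ha, h⟩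
  · rw [h]; simpa using h0
  · rw [h]; simpa using ha

theorem finite_nonempty_powerset :
    {F | F ∈ X.paths.powerset ∧ F.Nonempty}.Finite :=
  X.paths.powerset.finite_toSet.subset fun _ h => h.1

theorem measurableSet_survivors_eq (h0 : X.paths.Nonempty) {ψ : ℕ → Ω → ι → ℝ} {m : ℕ}
    (hψ : ∀ j ≤ m, Measurable (ψ j)) (G : Finset (ι → ℝ)) :
    MeasurableSet {ω | X.survivors (fun j => ψ j ω) m = G} := by
  induction m generalizing G with
  | zero => exact .const (X.paths = G)
  | succ m ih =>
    refine measurableSet_setOf_of_finite_range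
      (Q := fun F ω => X.epochStep (m + 1) F (ψ (m + 1) ω) = G) X.finite_nonempty_powerset
      (fun ω => X.survivors_mem _ h0 m) (fun F _ => ih (fun j hj => hψ j (by omega)) F)
      fun F hF => ?_
    exact hψ _ le_rfl (X.measurableSet_epochStep_eq (m + 1) hF.2 G)

theorem measurable_explorationEstimate (μ : ι → ℝ) {η : ℕ → Ω → ℝ} {m : ℕ}
    (hη : ∀ k < m * Fintype.card ι, Measurable (η k)) :
    Measurable fun ω => X.explorationEstimate μ (fun s => η s ω) m := by
  simp only [explorationEstimate, estimate, response_explorationHistory,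
    design_explorationHistory]
  have hx : Measurable fun ω => fun k : Fin (m * Fintype.card ι) => η k ω :=
    measurable_pi_lambda _ fun k => hη k k.2
  exact (Continuous.matrix_mulVec continuous_const (Continuous.matrix_mulVec continuous_const
    (continuous_const.add continuous_id))).measurable.comp hx

/-- Makes `historySigma` a sub-sigma-algebra of the ambient one, as conditioning on it requires. The
selection depends on the noise only through the surviving set, which has finitely many values. -/
theorem measurable_selectedPath (h0 : X.paths.Nonempty) (μ : ι → ℝ)
    {η : ℕ → Ω → ℝ} {t : ℕ} (hη : ∀ k < t, Measurable (η k)) :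
    Measurable fun ω => selectedPath X.policy μ (fun s => η s ω) t := by
  classical
  have heq : ∀ ω, selectedPath X.policy μ (fun s => η s ω) t =
      (fun F : Finset (ι → ℝ) => if h : ∃ a, F = {a} then h.choose else X.exploration t)
        (X.survivors (fun j => X.explorationEstimate μ (fun s => η s ω) j)
          (t / Fintype.card ι)) := fun ω => by
    rw [← X.remaining_playHistory μ (fun s => η s ω) _ t (Nat.div_mul_le_self _ _)]
    by_cases hF : ∃ a, X.remaining (playHistory X.policy μ (fun s => η s ω) t)
      (t / Fintype.card ι) = {a}
    · simp only [dif_pos hF]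
      exact X.selectedPath_of_eq_singleton hF.choose_spec
    · simp only [dif_neg hF]
      exact X.selectedPath_of_card_ne_one fun h => hF (Finset.card_eq_one.mp h)
  simp only [heq]
  intro B _
  refine measurableSet_setOf_of_finite_range
    (Q := fun (F : Finset (ι → ℝ)) (_ : Ω) =>
      (if h : ∃ a, F = {a} then h.choose else X.exploration t) ∈ B)
    X.finite_nonempty_powerset (fun ω => X.survivors_mem _ h0 _) (fun F _ => ?_)
    (fun F _ => .const _)
  refine X.measurableSet_survivors_eq h0 (fun j hj => X.measurable_explorationEstimate μ
    fun k hk => hη k ?_) F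
  exact hk.trans_le ((Nat.mul_le_mul_right _ hj).trans (Nat.div_mul_le_self _ _))

end TTCInput

/-! ### Concentration of weighted sums of the noise. -/

section Concentration

theorem historySigma_le {ι Ω : Type*} {m0 : MeasurableSpace Ω} {I : ℕ → Ω → ι → ℝ}
    {η : ℕ → Ω → ℝ} {t : ℕ} (hI : ∀ s < t, Measurable[m0] (I s))
    (hη : ∀ s < t, Measurable[m0] (η s)) : historySigma I η t ≤ m0 :=
  iSup_le fun s => sup_le (hI s s.2).comap_le (hη s s.2).comap_le

variable {ι : Type*} {Ω : Type*} [MeasurableSpace Ω] {P : Measure Ω} [IsProbabilityMeasure P]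
  {R : ℝ} {T : ℕ} {I : ℕ → Ω → ι → ℝ} {η : ℕ → Ω → ℝ}

/-- Peel off the last round: the earlier factor is measurable for the history, so conditioning on it
replaces the last factor by its bound. -/
theorem IsCondSubGaussianNoise.integrable_exp_sum_and_integral_le
    (h : IsCondSubGaussianNoise P R T I η) (hI : ∀ t < T, Measurable (I t)) {n : ℕ} (hn : n ≤ T)
    (c : ℕ → ℝ) :
    Integrable (fun ω => Real.exp (∑ k ∈ Finset.range n, c k * η k ω)) P ∧
      ∫ ω, Real.exp (∑ k ∈ Finset.range n, c k * η k ω) ∂P ≤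
        Real.exp ((∑ k ∈ Finset.range n, c k ^ 2) * R ^ 2 / 2) := by
  induction n generalizing c with
  | zero => simp
  | succ n ih =>
    have hn' : n < T := hn
    set f : Ω → ℝ := fun ω => Real.exp (∑ k ∈ Finset.range n, c k * η k ω) with hf
    set g : Ω → ℝ := fun ω => Real.exp (c n * η n ω) with hg
    have hfg : (fun ω => Real.exp (∑ k ∈ Finset.range (n + 1), c k * η k ω)) = f * g := by
      ext ω
      simp only [hf, hg, Pi.mul_apply]
      rw [Finset.sum_range_succ, Real.exp_add]
    have hfi : Integrable f P := (ih hn'.le c).1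
    have hgi : Integrable g P := h.integrable_exp n hn' (c n)
    -- `fg ≤ f² + g²`, and the squares are exponentials of the same kind with doubled weights; hence
    -- the induction over all `c`.
    have hprod : Integrable (f * g) P := by
      have h2f := (ih hn'.le fun k => 2 * c k).1
      have h2g := h.integrable_exp n hn' (2 * c n)
      refine (h2f.add h2g).mono' (hfi.aestronglyMeasurable.mul hgi.aestronglyMeasurable)
        (Filter.Eventually.of_forall fun ω => ?_)
      have e1 : Real.exp (∑ k ∈ Finset.range n, 2 * c k * η k ω) = f ω ^ 2 := by
        simp only [hf]
        rw [← Real.exp_nat_mul, Finset.mul_sum]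
        congr 1
        exact Finset.sum_congr rfl fun k _ => by push_cast; ring
      have e2 : Real.exp (2 * c n * η n ω) = g ω ^ 2 := by
        simp only [hg]
        rw [← Real.exp_nat_mul]
        congr 1
        push_cast
        ring
      have hf0 : 0 < f ω := Real.exp_pos _
      have hg0 : 0 < g ω := Real.exp_pos _
      simp only [Pi.mul_apply, Pi.add_apply, e1, e2]
      rw [Real.norm_of_nonneg (by positivity)]
      nlinarith [sq_nonneg (f ω - g ω)]
    have hle : historySigma I η n ≤ (inferInstance : MeasurableSpace Ω) :=
      historySigma_le (fun s hs => hI s (hs.trans hn')) fun s hs => h.measurable s (hs.trans hn')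
    have hfm : StronglyMeasurable[historySigma I η n] f := by
      refine Measurable.stronglyMeasurable ?_
      refine Real.measurable_exp.comp (Finset.measurable_sum _ fun k hk => ?_)
      refine Measurable.const_mul ?_ _
      refine Measurable.mono (comap_measurable (η k)) ?_ le_rfl
      exact le_sup_right.trans
        (le_iSup (fun s : Fin n => MeasurableSpace.comap (I s) inferInstance ⊔
          MeasurableSpace.comap (η s) inferInstance) ⟨k, Finset.mem_range.mp hk⟩)
    have hpull := condExp_mul_of_stronglyMeasurable_left hfm hprod hgi
    rw [hfg]
    refine ⟨hprod, ?_⟩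
    calc ∫ ω, (f * g) ω ∂P = ∫ ω, (P[f * g | historySigma I η n]) ω ∂P :=
          (integral_condExp hle).symm
      _ ≤ ∫ ω, f ω * Real.exp (c n ^ 2 * R ^ 2 / 2) ∂P := by
          refine integral_mono_ae integrable_condExp (hfi.mul_const _) ?_
          filter_upwards [hpull, h.condExp_exp_le n hn' (c n)] with ω h1 h2
          rw [h1]
          exact mul_le_mul_of_nonneg_left h2 (Real.exp_pos _).le
      _ = (∫ ω, f ω ∂P) * Real.exp (c n ^ 2 * R ^ 2 / 2) := integral_mul_const _ _
      _ ≤ Real.exp ((∑ k ∈ Finset.range n, c k ^ 2) * R ^ 2 / 2) *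
            Real.exp (c n ^ 2 * R ^ 2 / 2) :=
          mul_le_mul_of_nonneg_right (ih hn'.le c).2 (Real.exp_pos _).le
      _ = _ := by
          rw [← Real.exp_add, Finset.sum_range_succ]
          ring_nf

theorem IsCondSubGaussianNoise.hasSubgaussianMGF_sum
    (h : IsCondSubGaussianNoise P R T I η) (hI : ∀ t < T, Measurable (I t)) {n : ℕ} (hn : n ≤ T)
    (c : ℕ → ℝ) {v : NNReal} (hv : (∑ k ∈ Finset.range n, c k ^ 2) * R ^ 2 ≤ v) :
    HasSubgaussianMGF (fun ω => ∑ k ∈ Finset.range n, c k * η k ω) v P := by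
  have hs : ∀ t ω, t * ∑ k ∈ Finset.range n, c k * η k ω =
      ∑ k ∈ Finset.range n, (t * c k) * η k ω := fun t ω => by
    rw [Finset.mul_sum]
    exact Finset.sum_congr rfl fun k _ => by ring
  refine ⟨fun t => ?_, fun t => ?_⟩
  · simp only [hs]
    exact (h.integrable_exp_sum_and_integral_le hI hn fun k => t * c k).1
  · simp only [mgf, hs]
    refine (h.integrable_exp_sum_and_integral_le hI hn fun k => t * c k).2.trans ?_
    rw [Real.exp_le_exp]
    simp only [mul_pow, ← Finset.mul_sum]
    nlinarith [mul_le_mul_of_nonneg_left hv (sq_nonneg t)]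

theorem ProbabilityTheory.HasSubgaussianMGF.measureReal_abs_gt_le {Y : Ω → ℝ} {v : NNReal}
    (h : HasSubgaussianMGF Y v P) {ε : ℝ} (hε : 0 ≤ ε) :
    P.real {ω | ε < |Y ω|} ≤ 2 * Real.exp (-ε ^ 2 / (2 * v)) := by
  have hsub : {ω | ε < |Y ω|} ⊆ {ω | ε ≤ Y ω} ∪ {ω | ε ≤ (-Y) ω} := by
    intro ω hω
    rcases lt_abs.mp (show ε < |Y ω| from hω) with h1 | h1
    · exact Or.inl h1.le
    · exact Or.inr h1.le
  refine (measureReal_mono hsub).trans ((measureReal_union_le _ _).trans ?_)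
  have h1 := h.measure_ge_le hε
  have h2 := h.neg.measure_ge_le hε
  linarith

end Concentration

/-! ### Arithmetic of the epoch bound and the width. -/

theorem epochBound_nonneg (S R : ℝ) (d T : ℕ) (Δmin : ℝ) : 0 ≤ epochBound S R d T Δmin := by
  have := Real.log_natCast_nonneg T
  have := Real.log_nonneg (by norm_num : (1 : ℝ) ≤ 2)
  rw [epochBound]
  positivity

/-- The extra `2d` is absorbed because `Δmin ≤ d` gives `d ≤ d³ / Δmin²`; 128 is the coefficient of
`d log T` in `epochBound`. -/
theorem epochBound_add_two_mul_le {S R Δmin : ℝ} {d : ℕ} (T : ℕ) (hΔ : 0 < Δmin)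
    (hΔd : Δmin ≤ d) :
    (epochBound S R d T Δmin + 2) * d ≤
      128 * (1 + S ^ 2 * R ^ 2) * (((d : ℝ) ^ 2 * Real.log T + (d : ℝ) ^ 3) / Δmin ^ 2) := by
  have hlog := Real.log_natCast_nonneg T
  have hlog2 : Real.log 2 ≤ 1 := by linarith [Real.log_two_lt_d9]
  have hd0 : (0 : ℝ) < d := hΔ.trans_le hΔd
  set Q := ((d : ℝ) ^ 2 * Real.log T + (d : ℝ) ^ 3) / Δmin ^ 2 with hQ
  have hQd : (d : ℝ) ≤ Q := by
    rw [hQ, le_div_iff₀ (by positivity)]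
    have h1 : Δmin ^ 2 ≤ (d : ℝ) ^ 2 := by gcongr
    have h2 : 0 ≤ (d : ℝ) ^ 2 * Real.log T := by positivity
    nlinarith
  have hB : epochBound S R d T Δmin * d ≤ 128 * (S ^ 2 * R ^ 2) * Q := by
    have : epochBound S R d T Δmin * d = S ^ 2 * R ^ 2 *
        ((32 * Real.log 2 * (d : ℝ) ^ 3 + 128 * (d : ℝ) ^ 2 * Real.log T) / Δmin ^ 2) := by
      rw [epochBound]
      ring
    rw [this, mul_comm (128 : ℝ) (S ^ 2 * R ^ 2), mul_assoc (S ^ 2 * R ^ 2), hQ,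
      ← mul_div_assoc (128 : ℝ)]
    refine mul_le_mul_of_nonneg_left (div_le_div_of_nonneg_right ?_ (sq_nonneg Δmin))
      (by positivity)
    have : 0 < (d : ℝ) ^ 3 := by positivity
    nlinarith
  linarith

namespace TTCInput

variable {ι : Type*} [Fintype ι] (X : TTCInput ι)

theorem width_nonneg (hS : 0 ≤ X.S) (hR : 0 ≤ X.R) (m : ℕ) : 0 ≤ X.width m := by
  rw [width]
  positivity

theorem width_sq (m : ℕ) : X.width m ^ 2 = X.S ^ 2 * X.R ^ 2 *
    ((2 * Real.log 2 * (Fintype.card ι : ℝ) ^ 2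
      + 8 * (Fintype.card ι : ℝ) * Real.log X.T) / m) := by
  rw [width, mul_pow, mul_pow, Real.sq_sqrt]
  have := Real.log_natCast_nonneg X.T
  have := Real.log_nonneg (by norm_num : (1 : ℝ) ≤ 2)
  positivity

/-- The constants 32 and 128 are 16 times those in the width, so `(4 Δ̃_m)² = m̄ δ² / m`. -/
theorem four_mul_width_lt {δ : ℝ} (hδ : 0 < δ) {m : ℕ}
    (h : epochBound X.S X.R (Fintype.card ι) X.T δ < m) : 4 * X.width m < δ := by
  have hb : 0 ≤ epochBound X.S X.R (Fintype.card ι) X.T δ := epochBound_nonneg _ _ _ _ _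
  have hm : (0 : ℝ) < m := hb.trans_lt h
  refine lt_of_pow_lt_pow_left₀ 2 hδ.le ?_
  rw [mul_pow, width_sq]
  rw [epochBound, div_lt_iff₀ (by positivity)] at h
  have : (4 : ℝ) ^ 2 * (X.S ^ 2 * X.R ^ 2 * ((2 * Real.log 2 * (Fintype.card ι : ℝ) ^ 2
      + 8 * (Fintype.card ι : ℝ) * Real.log X.T) / m)) =
      X.S ^ 2 * X.R ^ 2 * (32 * Real.log 2 * (Fintype.card ι : ℝ) ^ 2
        + 128 * (Fintype.card ι : ℝ) * Real.log X.T) / m := by ring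
  rw [this, div_lt_iff₀ hm]
  linarith

section SinglePath

variable {X}

theorem remaining_of_card_eq_one (hc : X.paths.card = 1) (h : List ((ι → ℝ) × ℝ)) (m : ℕ) :
    X.remaining h m = X.paths := by
  induction m with
  | zero => rfl
  | succ m ih => rw [remaining_succ, ih, epochStep_of_card_eq_one _ hc]

theorem routingRegret_of_card_eq_one {μ astar : ι → ℝ} (hs : IsUniqueShortest X.paths μ astar)
    (hc : X.paths.card = 1) (T : ℕ) (x : ℕ → ℝ) : routingRegret X.paths X.policy μ T x = 0 := by
  obtain ⟨a, ha⟩ := Finset.card_eq_one.mp hc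
  have hstar : astar = a := by simpa [ha] using hs.1
  rw [routingRegret_eq_sum_gap hs]
  refine Finset.sum_eq_zero fun t _ => ?_
  rw [X.selectedPath_of_eq_singleton (a := a) (by rw [remaining_of_card_eq_one hc, ha]), hstar,
    sub_self, zero_dotProduct]

end SinglePath

/-! ### Regret under accurate estimates. -/

section Regret

variable {X} {μ astar : ι → ℝ}

theorem gap_selectedPath_mem_Icc (hs : IsUniqueShortest X.paths μ astar)
    (hb : ∀ i, X.basis i ∈ X.paths) (hd : 0 < Fintype.card ι) (x : ℕ → ℝ) (t : ℕ) :
    (selectedPath X.policy μ x t - astar) ⬝ᵥ μ ∈ Set.Icc 0 (gapMax X.paths μ astar) :=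
  gap_mem_Icc hs (X.selectedPath_mem ⟨_, hs.1⟩ hb hd μ x t)

theorem routingRegret_mem_Icc (hs : IsUniqueShortest X.paths μ astar)
    (hb : ∀ i, X.basis i ∈ X.paths) (hd : 0 < Fintype.card ι) (T : ℕ) (x : ℕ → ℝ) :
    routingRegret X.paths X.policy μ T x ∈ Set.Icc 0 (T * gapMax X.paths μ astar) := by
  have h := gap_selectedPath_mem_Icc hs hb hd x
  rw [routingRegret_eq_sum_gap hs]
  refine ⟨Finset.sum_nonneg fun t _ => (h t).1, ?_⟩
  simpa using Finset.sum_le_card_nsmul (Finset.range T) _ _ fun t _ => (h t).2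

/-- With accurate estimates, suboptimal paths are selected only in the first `⌊m̄⌋ + 1` epochs. -/
theorem routingRegret_le_of_accurate (hs : IsUniqueShortest X.paths μ astar)
    (hc : X.paths.card ≠ 1) (hb : ∀ i, X.basis i ∈ X.paths) (hd : 0 < Fintype.card ι)
    {x : ℕ → ℝ}
    (hx : ∀ m, 1 ≤ m → m ≤ X.T / Fintype.card ι → ∀ a ∈ X.paths,
      |a ⬝ᵥ X.explorationEstimate μ x m - a ⬝ᵥ μ| ≤ X.width m) :
    routingRegret X.paths X.policy μ X.T x ≤
      (epochBound X.S X.R (Fintype.card ι) X.T (gapMin X.paths μ astar) + 1) *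
        Fintype.card ι * gapMax X.paths μ astar := by
  set B := epochBound X.S X.R (Fintype.card ι) X.T (gapMin X.paths μ astar)
  have hB0 : 0 ≤ B := epochBound_nonneg _ _ _ _ _
  have hM := gapMax_nonneg hs
  -- `⌊B⌋₊ + 1` is the first epoch number strictly above `B`, as `four_mul_width_lt` needs.
  set K := (⌊B⌋₊ + 1) * Fintype.card ι with hK
  have hlate : ∀ t < X.T, K ≤ t → (selectedPath X.policy μ x t - astar) ⬝ᵥ μ = 0 := by
    intro t ht hKt
    have h1 : ⌊B⌋₊ + 1 ≤ t / Fintype.card ι := (Nat.le_div_iff_mul_le hd).mpr hKt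
    rw [X.selectedPath_of_eq_singleton (a := astar), sub_self, zero_dotProduct]
    rw [X.remaining_playHistory _ _ _ _ (Nat.div_mul_le_self _ _)]
    refine survivors_eq_singleton_of_width_lt hs hc hx (by omega) h1
      (Nat.div_le_div_right ht.le) (X.four_mul_width_lt (gapMin_pos hs hc) ?_)
    exact_mod_cast Nat.lt_floor_add_one B
  rw [routingRegret_eq_sum_gap hs]
  calc ∑ t ∈ Finset.range X.T, (selectedPath X.policy μ x t - astar) ⬝ᵥ μ
      ≤ ∑ t ∈ Finset.range X.T, if t < K then gapMax X.paths μ astar else 0 := by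
        refine Finset.sum_le_sum fun t ht => ?_
        split_ifs with h
        · exact (gap_selectedPath_mem_Icc hs hb hd x t).2
        · exact (hlate t (Finset.mem_range.mp ht) (not_lt.mp h)).le
    _ = ((Finset.range X.T).filter (· < K)).card * gapMax X.paths μ astar := by
        rw [← Finset.sum_filter, Finset.sum_const, nsmul_eq_mul]
    _ ≤ K * gapMax X.paths μ astar := by
        gcongr
        refine (Finset.card_le_card (t := Finset.range K) fun t ht => ?_).trans
          (Finset.card_range K).le
        exact Finset.mem_range.mpr (Finset.mem_filter.mp ht).2
    _ ≤ _ := by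
        rw [hK]
        push_cast
        gcongr
        exact Nat.floor_le hB0

end Regret

section Accuracy

variable {Ω : Type*} {μ : ι → ℝ} {η : ℕ → Ω → ℝ}

/-- The event that the estimate of some path delay in some completed epoch of exploration is off
by more than the confidence width. -/
def inaccurate (μ : ι → ℝ) (η : ℕ → Ω → ℝ) : Set Ω :=
  ⋃ m ∈ Finset.Icc 1 (X.T / Fintype.card ι), ⋃ a ∈ X.paths,
    {ω | X.width m < |a ⬝ᵥ X.explorationEstimate μ (fun s => η s ω) m - a ⬝ᵥ μ|}

theorem notMem_inaccurate {ω : Ω} (h : ω ∉ X.inaccurate μ η) (m : ℕ) (hm : 1 ≤ m)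
    (hm' : m ≤ X.T / Fintype.card ι) (a : ι → ℝ) (ha : a ∈ X.paths) :
    |a ⬝ᵥ X.explorationEstimate μ (fun s => η s ω) m - a ⬝ᵥ μ| ≤ X.width m := by
  by_contra hlt
  refine h (Set.mem_biUnion (Finset.mem_coe.mpr (Finset.mem_Icc.mpr ⟨hm, hm'⟩))
    (Set.mem_biUnion (Finset.mem_coe.mpr ha) ?_))
  exact not_le.mp hlt

variable {X} {astar : ι → ℝ}

/-- If all estimates are accurate, then an elimination leaves exactly the shortest path. -/
theorem remaining_eq_of_separated (hs : IsUniqueShortest X.paths μ astar) {ω : Ω}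
    (hd : 0 < Fintype.card ι) (hω : ω ∉ X.inaccurate μ η) {m : ℕ}
    (hm : (m + 1) * Fintype.card ι ≤ X.T)
    (h1 : (X.remaining (playHistory X.policy μ (fun s => η s ω) X.T) m).card ≠ 1)
    (h2 : X.Separated (playHistory X.policy μ (fun s => η s ω) X.T)
      (X.remaining (playHistory X.policy μ (fun s => η s ω) X.T) m) (m + 1)) :
    X.remaining (playHistory X.policy μ (fun s => η s ω) X.T) (m + 1) = {astar} := by
  have hc : X.paths.card ≠ 1 := fun hc => h1 (by rw [remaining_of_card_eq_one hc, hc])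
  have hmT : m + 1 ≤ X.T / Fintype.card ι := (Nat.le_div_iff_mul_le hd).mpr hm
  -- Accuracy leaves only two possible states, all paths or `{astar}`; cardinality decides between
  -- them.
  have hone : (X.remaining (playHistory X.policy μ (fun s => η s ω) X.T) (m + 1)).card = 1 := by
    rw [remaining, if_neg h1, if_pos h2, Finset.card_singleton]
  rw [X.remaining_playHistory _ _ _ _ hm] at hone ⊢
  rcases survivors_eq_of_accurate hs hc (X.notMem_inaccurate hω) hmT with h | h
  · exact absurd (h ▸ hone) hc
  · exact h

end Accuracy

/-! ### Probability of the bad event and expected regret. -/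

section Probability

variable {Ω : Type*} [MeasurableSpace Ω] {P : Measure Ω} [IsProbabilityMeasure P]
  {μ astar : ι → ℝ} {η : ℕ → Ω → ℝ}

theorem measurableSet_inaccurate (hη : ∀ t < X.T, Measurable (η t)) :
    MeasurableSet (X.inaccurate μ η) := by
  refine Finset.measurableSet_biUnion _ fun m hm => Finset.measurableSet_biUnion _ fun a _ => ?_
  have h := X.measurable_explorationEstimate μ (m := m) fun k hk => hη k (hk.trans_le
    ((Nat.mul_le_mul_right _ (Finset.mem_Icc.mp hm).2).trans (Nat.div_mul_le_self _ _)))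
  exact measurableSet_lt measurable_const
    (continuous_abs.measurable.comp ((measurable_const.dotProduct h).sub_const _))

variable {X}

theorem measureReal_width_lt_le
    (hnoise : IsCondSubGaussianNoise P X.R X.T
      (fun t ω => selectedPath X.policy μ (fun s => η s ω) t) η)
    (h0 : X.paths.Nonempty) (hd : 0 < Fintype.card ι) (hli : LinearIndependent ℝ X.basis)
    (hR : 0 ≤ X.R) (hS : 0 ≤ X.S) (hT : 0 < X.T) {m : ℕ} (hm : 0 < m)
    (hmT : m * Fintype.card ι ≤ X.T) {a : ι → ℝ} {ν : Fin (Fintype.card ι) → ℝ}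
    (hν : ∀ i, ν i ∈ Set.Icc (-X.S) X.S) (ha : a = ∑ i, ν i • X.basis i) :
    P.real {ω | X.width m < |a ⬝ᵥ X.explorationEstimate μ (fun s => η s ω) m - a ⬝ᵥ μ|} ≤
      2 * ((1 / 2) ^ Fintype.card ι * (1 / (X.T : ℝ) ^ 4)) := by
  have hm0 : (0 : ℝ) < m := by exact_mod_cast hm
  have hd0 : (0 : ℝ) < Fintype.card ι := by exact_mod_cast hd
  have hT0 : (0 : ℝ) < X.T := by exact_mod_cast hT
  simp only [X.dotProduct_explorationEstimate hd hli μ _ hm ha]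
  -- There are `m d` weights, each with square at most `S² / m²`. With this `v`, `Δ̃_m² / (2v) = d
  -- log 2 + 4 log T`.
  set v : NNReal := ⟨Fintype.card ι * X.S ^ 2 / m * X.R ^ 2, by positivity⟩ with hv
  have hI : ∀ t < X.T, Measurable fun ω => selectedPath X.policy μ (fun s => η s ω) t :=
    fun t ht => X.measurable_selectedPath h0 μ fun k hk => hnoise.measurable k (hk.trans ht)
  have hsub := hnoise.hasSubgaussianMGF_sum hI hmT
    (fun k => ν ⟨k % Fintype.card ι, Nat.mod_lt _ hd⟩ / m) (v := v) (by
      refine mul_le_mul_of_nonneg_right ?_ (sq_nonneg _)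
      refine (Finset.sum_le_card_nsmul _ _ (X.S ^ 2 / m ^ 2) fun k _ => ?_).trans ?_
      · rw [div_pow]
        exact div_le_div_of_nonneg_right (sq_le_sq' (hν _).1 (hν _).2) (sq_nonneg _)
      · rw [Finset.card_range, nsmul_eq_mul]
        push_cast
        refine le_of_eq ?_
        field_simp)
  have hw := X.width_nonneg hS hR m
  -- If `S R = 0`, the tail exponent would be `0 / 0`; instead the error vanishes almost surely.
  rcases eq_or_ne (X.S * X.R) 0 with hSR | hSR
  · have hv0 : v = 0 := by
      ext
      change (Fintype.card ι : ℝ) * X.S ^ 2 / m * X.R ^ 2 = 0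
      have : (Fintype.card ι : ℝ) * X.S ^ 2 / m * X.R ^ 2 =
        Fintype.card ι / m * (X.S * X.R) ^ 2 := by ring
      rw [this, hSR]
      simp
    rw [hv0] at hsub
    refine le_of_eq_of_le (b := 0) ?_ (by positivity)
    rw [measureReal_eq_zero_iff]
    refine measure_mono_null (fun ω hω => ?_)
      (ae_iff.mp hsub.ae_eq_zero_of_hasSubgaussianMGF_zero)
    intro h
    have h' : X.width m < |∑ k ∈ Finset.range (m * Fintype.card ι),
      ν ⟨k % Fintype.card ι, Nat.mod_lt _ hd⟩ / m * η k ω| := hω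
    have h'' : ∑ k ∈ Finset.range (m * Fintype.card ι),
      ν ⟨k % Fintype.card ι, Nat.mod_lt _ hd⟩ / m * η k ω = 0 := h
    rw [h'', abs_zero] at h'
    exact absurd hw (not_le.mpr h')
  · refine (hsub.measureReal_abs_gt_le hw).trans (le_of_eq ?_)
    have hS0 : X.S ≠ 0 := left_ne_zero_of_mul hSR
    have hR0 : X.R ≠ 0 := right_ne_zero_of_mul hSR
    have hexp : -X.width m ^ 2 / (2 * (v : ℝ)) =
        -(Fintype.card ι * Real.log 2 + (4 : ℕ) * Real.log X.T) := by
      change -X.width m ^ 2 / (2 * (Fintype.card ι * X.S ^ 2 / m * X.R ^ 2)) = _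
      rw [width_sq]
      field_simp
      push_cast
      ring
    rw [hexp, Real.exp_neg, Real.exp_add, Real.exp_nat_mul, Real.exp_nat_mul,
      Real.exp_log two_pos, Real.exp_log hT0, mul_inv, one_div, inv_pow, one_div]

theorem measureReal_inaccurate_le
    (hnoise : IsCondSubGaussianNoise P X.R X.T
      (fun t ω => selectedPath X.policy μ (fun s => η s ω) t) η)
    (h0 : X.paths.Nonempty) (hd : 0 < Fintype.card ι) (hli : LinearIndependent ℝ X.basis)
    (hR : 0 ≤ X.R) (hS : 0 ≤ X.S)
    (hspan : ∀ a ∈ X.paths, ∃ ν : Fin (Fintype.card ι) → ℝ,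
      (∀ i, ν i ∈ Set.Icc (-X.S) X.S) ∧ a = ∑ i, ν i • X.basis i)
    (hcard : X.paths.card ≤ 2 ^ Fintype.card ι) :
    P.real (X.inaccurate μ η) ≤ 1 / (Fintype.card ι * X.T) := by
  have hd0 : (0 : ℝ) < Fintype.card ι := by exact_mod_cast hd
  rcases lt_or_ge X.T (Fintype.card ι) with hTd | hTd
  · have : X.inaccurate μ η = ∅ := by
      simp [inaccurate, Nat.div_eq_of_lt hTd]
    rw [this, measureReal_empty]
    positivity
  have hT : 0 < X.T := hd.trans_le hTd
  have hT0 : (0 : ℝ) < X.T := by exact_mod_cast hT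
  -- The union bound gives `2 / (d T³)`, which is at most `1 / (d T)` only for `T ≥ 2`. For `T = d =
  -- 1` the claimed bound is 1.
  rcases Nat.lt_or_ge X.T 2 with hT1 | hT2
  · have h1 : X.T = 1 := by omega
    have h2 : Fintype.card ι = 1 := by omega
    rw [h1, h2]
    simp
  calc P.real (X.inaccurate μ η)
      ≤ ∑ m ∈ Finset.Icc 1 (X.T / Fintype.card ι), ∑ a ∈ X.paths,
          2 * ((1 / 2) ^ Fintype.card ι * (1 / (X.T : ℝ) ^ 4)) := by
        refine (measureReal_biUnion_finset_le _ _).trans (Finset.sum_le_sum fun m hm => ?_)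
        refine (measureReal_biUnion_finset_le _ _).trans (Finset.sum_le_sum fun a ha => ?_)
        obtain ⟨ν, hν, hae⟩ := hspan a ha
        have hm' := Finset.mem_Icc.mp hm
        exact measureReal_width_lt_le hnoise h0 hd hli hR hS hT hm'.1
          ((Nat.mul_le_mul_right _ hm'.2).trans (Nat.div_mul_le_self _ _)) hν hae
    _ = (X.T / Fintype.card ι : ℕ) *
          (X.paths.card * (2 * ((1 / 2) ^ Fintype.card ι * (1 / (X.T : ℝ) ^ 4)))) := by
        simp
    _ ≤ (X.T / Fintype.card ι : ℝ) *
          (2 ^ Fintype.card ι * (2 * ((1 / 2) ^ Fintype.card ι * (1 / (X.T : ℝ) ^ 4)))) := by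
        gcongr
        · exact Nat.cast_div_le
        · exact_mod_cast hcard
    _ = 2 / (X.T : ℝ) ^ 2 * (1 / (Fintype.card ι * X.T)) := by
        rw [one_div_pow]
        field_simp
    _ ≤ 1 * (1 / (Fintype.card ι * X.T)) := by
        gcongr
        rw [div_le_one (by positivity)]
        have : (2 : ℝ) ≤ X.T := by exact_mod_cast hT2
        nlinarith
    _ = _ := one_mul _

theorem integrable_routingRegret (hs : IsUniqueShortest X.paths μ astar)
    (hb : ∀ i, X.basis i ∈ X.paths) (hd : 0 < Fintype.card ι)
    (hη : ∀ t < X.T, Measurable (η t)) :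
    Integrable (fun ω => routingRegret X.paths X.policy μ X.T (fun s => η s ω)) P := by
  refine Integrable.of_mem_Icc 0 (X.T * gapMax X.paths μ astar) (Measurable.aemeasurable ?_)
    (Filter.Eventually.of_forall fun ω => routingRegret_mem_Icc hs hb hd _ _)
  simp only [routingRegret_eq_sum_gap hs]
  refine Finset.measurable_sum _ fun t ht => ?_
  refine Measurable.dotProduct (Measurable.sub_const ?_ _) measurable_const
  exact X.measurable_selectedPath ⟨_, hs.1⟩ μ fun k hk =>
    hη k (hk.trans (Finset.mem_range.mp ht))

/-- On the bad event the regret is at most `T Δ_max`, and `T · 1 / (d T) ≤ d`; this is the second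
extra epoch. -/
theorem integral_routingRegret_le (hs : IsUniqueShortest X.paths μ astar)
    (hc : X.paths.card ≠ 1) (hb : ∀ i, X.basis i ∈ X.paths) (hd : 0 < Fintype.card ι)
    (hη : ∀ t < X.T, Measurable (η t))
    (hbad : P.real (X.inaccurate μ η) ≤ 1 / (Fintype.card ι * X.T)) :
    ∫ ω, routingRegret X.paths X.policy μ X.T (fun s => η s ω) ∂P ≤
      (epochBound X.S X.R (Fintype.card ι) X.T (gapMin X.paths μ astar) + 2) *
        Fintype.card ι * gapMax X.paths μ astar := by
  have hM := gapMax_nonneg hs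
  have hd1 : (1 : ℝ) ≤ Fintype.card ι := by exact_mod_cast hd
  set B := epochBound X.S X.R (Fintype.card ι) X.T (gapMin X.paths μ astar)
  have hB0 : 0 ≤ B := epochBound_nonneg _ _ _ _ _
  have hms := X.measurableSet_inaccurate (μ := μ) hη
  have hint : Integrable ((X.inaccurate μ η).indicator
      fun _ => (X.T : ℝ) * gapMax X.paths μ astar) P :=
    (integrable_const _).indicator hms
  calc ∫ ω, routingRegret X.paths X.policy μ X.T (fun s => η s ω) ∂P
      ≤ ∫ ω, ((B + 1) * Fintype.card ι * gapMax X.paths μ astar +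
          (X.inaccurate μ η).indicator (fun _ => (X.T : ℝ) * gapMax X.paths μ astar) ω) ∂P := by
        refine integral_mono (integrable_routingRegret hs hb hd hη)
          ((integrable_const _).add hint) fun ω => ?_
        by_cases hω : ω ∈ X.inaccurate μ η
        · simp only [Set.indicator_of_mem hω]
          refine (routingRegret_mem_Icc hs hb hd _ _).2.trans (le_add_of_nonneg_left ?_)
          positivity
        · simp only [Set.indicator_of_notMem hω, add_zero]
          exact routingRegret_le_of_accurate hs hc hb hd (X.notMem_inaccurate hω)
    _ = (B + 1) * Fintype.card ι * gapMax X.paths μ astar +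
          P.real (X.inaccurate μ η) * X.T * gapMax X.paths μ astar := by
        rw [integral_add (integrable_const _) hint, integral_const, integral_indicator_const _ hms]
        simp [mul_assoc]
    _ ≤ (B + 1) * Fintype.card ι * gapMax X.paths μ astar +
          Fintype.card ι * gapMax X.paths μ astar := by
        gcongr
        rcases X.T.eq_zero_or_pos with h | h
        · simp [h]
        · have hT0 : (0 : ℝ) < X.T := by exact_mod_cast h
          rw [le_div_iff₀ (by positivity)] at hbad
          nlinarith [mul_nonneg (mul_nonneg (measureReal_nonneg (μ := P)
            (s := X.inaccurate μ η)) hT0.le) (sub_nonneg.mpr hd1)]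
    _ = _ := by ring

end Probability

end TTCInput

/-! ### Path vectors, spanners and the final assembly. -/

namespace RoutingNetwork

variable {V E : Type*} (N : RoutingNetwork V E)

theorem mem_pathSet [Finite E] {a : N.InternalLink → ℝ} : a ∈ N.pathSet ↔ a ∈ N.pathVectors :=
  N.pathVectors_finite.mem_toFinset

theorem card_pathSet_le [Finite E] : N.pathSet.card ≤ 2 ^ Fintype.card N.InternalLink := by
  classical
  rw [← Fintype.card_finset, ← Finset.card_univ]
  refine (Finset.card_le_card fun a ha => ?_).trans (Finset.card_image_le
    (f := fun (F : Finset N.InternalLink) e => if e ∈ F then (1 : ℝ) else 0))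
  obtain ⟨p, -, rfl⟩ := N.mem_pathSet.mp ha
  refine Finset.mem_image.mpr ⟨Finset.univ.filter fun e : N.InternalLink => e.1 ∈ p,
    Finset.mem_univ _, ?_⟩
  ext e
  simp [pathVector]

theorem gapMin_le_card [Finite E] {μ astar : N.InternalLink → ℝ}
    (hμ : ∀ e, μ e ∈ Set.Icc (0 : ℝ) 1) (hs : IsUniqueShortest N.pathSet μ astar)
    (hc : N.pathSet.card ≠ 1) : gapMin N.pathSet μ astar ≤ Fintype.card N.InternalLink := by
  obtain ⟨a, ha, hne⟩ := N.pathSet.exists_mem_ne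
    (lt_of_le_of_ne (Finset.card_pos.mpr ⟨_, hs.1⟩) hc.symm) astar
  refine (gapMin_le_gap ha hne).trans ?_
  have h01 : ∀ a ∈ N.pathSet, ∀ e, a e ∈ Set.Icc (0 : ℝ) 1 := by
    intro a ha e
    obtain ⟨p, -, rfl⟩ := N.mem_pathSet.mp ha
    rw [pathVector]
    split_ifs <;> simp
  calc (a - astar) ⬝ᵥ μ ≤ ∑ _e : N.InternalLink, (1 : ℝ) := by
        refine Finset.sum_le_sum fun e _ => ?_
        have h1 := h01 a ha e
        have h2 := h01 astar hs.1 e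
        have h3 := hμ e
        have h4 : (a - astar) e ≤ 1 := by
          rw [Pi.sub_apply]
          linarith [h1.2, h2.1]
        nlinarith [mul_le_mul_of_nonneg_right h4 h3.1, h3.2]
    _ = _ := by simp

end RoutingNetwork

/-- An approximate barycentric spanner of a spanning set is linearly independent. -/
theorem IsApproxBarycentricSpanner.linearIndependent {W : Type*} [AddCommGroup W] [Module ℝ W]
    {W₀ : Set W} {S : ℝ} {d : ℕ} {b : Fin d → W} (h : IsApproxBarycentricSpanner W₀ S b)
    (hW : Submodule.span ℝ W₀ = ⊤) : LinearIndependent ℝ b := by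
  obtain ⟨hfin, -, hsp⟩ := h
  refine linearIndependent_of_top_le_span_of_card_eq_finrank ?_ ?_
  · rw [← hW, Submodule.span_le]
    intro x hx
    obtain ⟨ν, -, rfl⟩ := hsp x hx
    exact Submodule.sum_mem _ fun i _ =>
      Submodule.smul_mem _ _ (Submodule.subset_span ⟨i, rfl⟩)
  · rw [hW, finrank_top] at hfin
    rw [hfin, Fintype.card_fin]

theorem theorem2 :
    ∃ C : ℝ, 0 < C ∧
      ∀ (V E : Type*) [Finite E] (N : RoutingNetwork V E)
        (_ : N.Acyclic) (_ : N.Identifiable)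
        (S R : ℝ) (_ : 0 ≤ R) (T : ℕ)
        (b : Fin (Fintype.card N.InternalLink) → N.InternalLink → ℝ)
        (_ : IsApproxBarycentricSpanner N.pathVectors S b)
        (rule : ArgminRule N.InternalLink)
        (X : TTCInput N.InternalLink)
        (_ : X = { paths := N.pathSet, basis := b, S := S, R := R, T := T, argmin := rule })
        (μ : N.InternalLink → ℝ) (_ : ∀ e, μ e ∈ Set.Icc (0 : ℝ) 1)
        (astar : N.InternalLink → ℝ) (_ : IsUniqueShortest N.pathSet μ astar)
        (Ω : Type*) [MeasurableSpace Ω] (P : Measure Ω) [IsProbabilityMeasure P]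
        (η : ℕ → Ω → ℝ)
        (_ : IsCondSubGaussianNoise P R T
          (fun t ω => selectedPath X.policy μ (fun s => η s ω) t) η)
        (d : ℕ) (_ : d = Fintype.card N.InternalLink)
        (Δmin Δmax : ℝ) (_ : Δmin = gapMin N.pathSet μ astar)
        (_ : Δmax = gapMax N.pathSet μ astar)
        (_ : (d : ℝ) * epochBound S R d T Δmin ≤ T),
        -- the regret bound
        (Integrable (fun ω => routingRegret N.pathSet X.policy μ T (fun s => η s ω)) P ∧
          ∫ ω, routingRegret N.pathSet X.policy μ T (fun s => η s ω) ∂P ≤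
            C * (1 + S ^ 2 * R ^ 2) *
              (((d : ℝ) ^ 2 * Real.log T + (d : ℝ) ^ 3) * Δmax / Δmin ^ 2)) ∧
        -- with probability at least `1 - 1 / (d T)`: in every completed epoch of exploration, if
        -- the estimated gap exceeds twice the confidence width, exactly the optimal path survives
        P {ω | ¬ ∀ m : ℕ, (m + 1) * d ≤ T →
            (X.remaining (playHistory X.policy μ (fun s => η s ω) T) m).card ≠ 1 →
            X.Separated (playHistory X.policy μ (fun s => η s ω) T)
              (X.remaining (playHistory X.policy μ (fun s => η s ω) T) m) (m + 1) →
            X.remaining (playHistory X.policy μ (fun s => η s ω) T) (m + 1) = {astar}} ≤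
          ENNReal.ofReal (1 / ((d : ℝ) * T)) := by
  refine ⟨128, by norm_num, ?_⟩
  intro V E _ N _ hspan S R hR T b hb rule X hX μ hμ astar hs Ω _ P _ η hnoise d hd Δmin Δmax
    hmin hmax _
  have hpaths : N.pathSet = X.paths := by rw [hX]
  have hbasis : b = X.basis := by rw [hX]
  have hXS : S = X.S := by rw [hX]
  have hXR : R = X.R := by rw [hX]
  have hXT : T = X.T := by rw [hX]
  clear hX
  have hcard := N.card_pathSet_le
  have hΔd := N.gapMin_le_card hμ hs
  have hli := hb.linearIndependent hspan
  obtain ⟨-, hbmem, hcoef⟩ := hb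
  simp only [← N.mem_pathSet] at hbmem hcoef
  rw [hpaths] at hs hmin hmax hbmem hcoef hcard hΔd ⊢
  subst hbasis hXS hXR hXT hd hmin hmax
  by_cases hc : X.paths.card = 1
  -- With one path, `gapMax` is `sSup ∅ = 0`, so both sides of the regret bound are 0.
  · have hempty : gapSet X.paths μ astar = ∅ := by
      obtain ⟨a, ha⟩ := Finset.card_eq_one.mp hc
      have := hs.1
      simp only [ha, Finset.mem_singleton] at this
      simp [gapSet, ha, this]
    simp only [TTCInput.routingRegret_of_card_eq_one hs hc]
    refine ⟨⟨integrable_zero _ _ _, ?_⟩, ?_⟩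
    · simp [gapMax, hempty]
    · simp [TTCInput.remaining_of_card_eq_one hc, hc]
  -- Without internal links all path vectors coincide, which contradicts `hc`.
  have hd : 0 < Fintype.card N.InternalLink := by
    by_contra h0
    have := Fintype.card_eq_zero_iff.mp (Nat.eq_zero_of_not_pos h0)
    exact hc (le_antisymm (Finset.card_le_one_of_subsingleton _) (Finset.card_pos.mpr ⟨_, hs.1⟩))
  have hS : 0 ≤ X.S := by
    obtain ⟨ν, hν, -⟩ := hcoef astar hs.1
    have := hν ⟨0, hd⟩
    linarith [this.1, this.2]
  have hbad := TTCInput.measureReal_inaccurate_le hnoise ⟨_, hs.1⟩ hd hli hR hS hcoef hcard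
  refine ⟨⟨TTCInput.integrable_routingRegret hs hbmem hd hnoise.measurable, ?_⟩, ?_⟩
  · refine (TTCInput.integral_routingRegret_le hs hc hbmem hd hnoise.measurable hbad).trans ?_
    have h := mul_le_mul_of_nonneg_right (epochBound_add_two_mul_le (S := X.S) (R := X.R)
      X.T (gapMin_pos hs hc) (hΔd hc)) (gapMax_nonneg hs)
    refine h.trans_eq ?_
    ring
  · refine (measure_mono (t := X.inaccurate μ η) fun ω hω => ?_).trans ?_
    · by_contra hgood
      exact hω fun m hm h1 h2 => TTCInput.remaining_eq_of_separated hs hd hgood hm h1 h2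
    · rw [← ofReal_measureReal]
      exact ENNReal.ofReal_le_ofReal hbad
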